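/- Let $\Omega\subset\mathbb R^N$ be a bounded open set with $C^3$ boundary, and let $\mathcal S^N$ be the space of symmetric $N\times N$ real matrices. Let $F:\mathcal S^N\times\mathbb R^N\times\mathbb R\times\overline\Omega\to\mathbb R$ be continuous and (degenerate) elliptic, i.e. $F(X,p,r,x)\le F(Y,p,r,x)$ whenever $X\ge Y$. Assume that there is $m>2$ such that $F$ satisfies (H4') for every $R>0$ there are constants $K_1^R,K_2^R>0$ and a Lipschitz continuous function $\tilde G_R:\mathcal S^N\to\mathbb R$ which is elliptic ($\tilde G_R(X)\le\tilde G_R(Y)$ if $X\ge Y$) and positively homogeneous of degree $1$, such that, for all $M\in\mathcal S^N$, $p\in\mathbb R^N$, $|r|\le R$ and $x\in\overline\Omega$, $$F(M,p,r,x)\le 0\quad\Longrightarrow\quad \tilde G_R(M)+K_1^R|p|^m-K_2^R\le 0 .$$ Let $g\in C(\partial\Omega)$, and let $u:\overline\Omega\to\mathbb R$ be a bounded upper semicontinuous viscosity subsolution of the generalized Dirichlet problem, that is: for every $\varphi\in C^2(\mathbb R^N)$ and every local maximum point $x\in\overline\Omega$ of $u-\varphi$ relative to $\overline\Omega$, $$F(D^2\varphi(x),D\varphi(x),u(x),x)\le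 0\quad\text{if }x\in\Omega,$$ $$\min\bigl(F(D^2\varphi(x),D\varphi(x),u(x),x),\,u(x)-g(x)\bigr)\le 0\quad\text{if }x\in\partial\Omega .$$ Then $u\le g$ on $\partial\Omega$. -/

import Mathlib

open Set Topology

noncomputable section

/-- `ℝ^N` with its Euclidean norm. -/
abbrev RN (N : ℕ) : Type := EuclideanSpace ℝ (Fin N)

/-- `N × N` real matrices. The space `S^N` is the subset of those `X` with `X.IsSymm`; functions of a
symmetric matrix are written as functions on all matrices, and only their values on symmetric
matrices matter. -/
abbrev Mat (N : ℕ) : Type := Matrix (Fin N) (Fin N) ℝ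

/-- The Frobenius norm of a matrix. -/
def frobNorm {N : ℕ} (X : Mat N) : ℝ := Real.sqrt (∑ i, ∑ j, X i j ^ 2)

/-- The Hessian matrix `D²φ(x)` (symmetric as soon as `φ` is of class `C²`). -/
def hessian {N : ℕ} (φ : RN N → ℝ) (x : RN N) : Mat N :=
  Matrix.of fun i j =>
    iteratedFDeriv ℝ 2 φ x ![EuclideanSpace.single i (1 : ℝ), EuclideanSpace.single j (1 : ℝ)]

/-- `Ω` has a boundary of class `C³`: near each of its boundary points, `Ω` is the set where a `C³`
function with nonvanishing derivative at that point is positive. (As only the values of `ρ` near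
`x₀` matter, it is no restriction that `ρ` is `C³` on the whole space.) -/
def HasC3Boundary {N : ℕ} (Ω : Set (RN N)) : Prop :=
  ∀ x₀ ∈ frontier Ω, ∃ U ∈ 𝓝 x₀, ∃ ρ : RN N → ℝ,
    ContDiff ℝ 3 ρ ∧ fderiv ℝ ρ x₀ ≠ 0 ∧ ∀ x ∈ U, (x ∈ Ω ↔ 0 < ρ x)

/-- `F` is continuous on `S^N × ℝ^N × ℝ × closure Ω`. -/
def ContinuousNonlinearity {N : ℕ} (Ω : Set (RN N)) (F : Mat N → RN N → ℝ → RN N → ℝ) : Prop :=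
  ContinuousOn (fun q : Mat N × RN N × ℝ × RN N => F q.1 q.2.1 q.2.2.1 q.2.2.2)
    {q | q.1.IsSymm ∧ q.2.2.2 ∈ closure Ω}

/-- The ellipticity condition for a function of a symmetric matrix: `G X ≤ G Y` if `X ≥ Y`. -/
def EllipticMat {N : ℕ} (G : Mat N → ℝ) : Prop :=
  ∀ X Y : Mat N, X.IsSymm → Y.IsSymm → (X - Y).PosSemidef → G X ≤ G Y

/-- The (degenerate) ellipticity condition for `F(D²u, Du, u, x)` in `Ω`. -/
def Elliptic {N : ℕ} (Ω : Set (RN N)) (F : Mat N → RN N → ℝ → RN N → ℝ) : Prop :=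
  ∀ (p : RN N) (r : ℝ), ∀ x ∈ Ω, EllipticMat fun X => F X p r x

/-- Lipschitz continuity on the space of symmetric matrices. -/
def LipschitzMat {N : ℕ} (G : Mat N → ℝ) : Prop :=
  ∃ L : ℝ, ∀ X Y : Mat N, X.IsSymm → Y.IsSymm → |G X - G Y| ≤ L * frobNorm (X - Y)

/-- (Positive) homogeneity of degree one on the space of symmetric matrices. -/
def HomogeneousMat {N : ℕ} (G : Mat N → ℝ) : Prop :=
  ∀ (t : ℝ) (X : Mat N), 0 < t → X.IsSymm → G (t • X) = t * G X

/-- The superquadratic growth assumption with exponent `m` (the function `G` is `G̃_R`). -/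
def SuperquadraticGrowth {N : ℕ} (m : ℝ) (Ω : Set (RN N))
    (F : Mat N → RN N → ℝ → RN N → ℝ) : Prop :=
  ∀ R : ℝ, 0 < R → ∃ (K₁ K₂ : ℝ) (G : Mat N → ℝ), 0 < K₁ ∧ 0 < K₂ ∧
    LipschitzMat G ∧ EllipticMat G ∧ HomogeneousMat G ∧
    ∀ (M : Mat N) (p : RN N) (r : ℝ) (x : RN N), M.IsSymm → |r| ≤ R → x ∈ closure Ω →
      F M p r x ≤ 0 → G M + K₁ * ‖p‖ ^ m - K₂ ≤ 0

/-- `u` satisfies the viscosity subsolution inequalities of the generalized Dirichlet problem: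
`F(D²u, Du, u, x) ≤ 0` in `Ω` and `min (F(D²u, Du, u, x)) (u - g) ≤ 0` on `∂Ω`, tested by `C²`
functions `φ` at the maximum points of `u - φ` relative to `closure Ω`. -/
def IsDirichletSubsolution {N : ℕ} (Ω : Set (RN N)) (F : Mat N → RN N → ℝ → RN N → ℝ)
    (g u : RN N → ℝ) : Prop :=
  ∀ φ : RN N → ℝ, ContDiff ℝ 2 φ → ∀ x ∈ closure Ω,
    IsLocalMaxOn (fun y => u y - φ y) (closure Ω) x →
      (x ∈ Ω → F (hessian φ x) (gradient φ x) (u x) x ≤ 0) ∧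
      (x ∈ frontier Ω → min (F (hessian φ x) (gradient φ x) (u x) x) (u x - g x) ≤ 0)

end

/-! If `u x₀ > g x₀`, test `u` with `φ = a ρ + b |x - x₀|²`, where `ρ` is a local defining function
of `Ω`. As `ρ ≥ 0` on the closure near `x₀` and `ρ x₀ ≤ 0`, a maximum point `x` of `u - φ` near `x₀`
has `u x ≥ u x₀`. Hence `u x > g x` if `x` lies on the boundary, and the equation holds at `x` in
either case. There `D²φ` is at most of order `a`, while `|Dφ|` is at least of order `a`, so `K₁
|Dφ|^m` outgrows the linear bound on `G` (`eventually_superquadratic`): a contradiction for large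
`a`. -/

theorem frobNorm_le_of_abs_le {N : ℕ} {X : Mat N} {s : ℝ} (h : ∀ i j, |X i j| ≤ s) (hs : 0 ≤ s) :
    frobNorm X ≤ N * s := by
  unfold frobNorm
  refine Real.sqrt_le_iff.2 ⟨by positivity, ?_⟩
  calc ∑ i, ∑ j, X i j ^ 2 ≤ ∑ _i : Fin N, ∑ _j : Fin N, s ^ 2 := by
        refine Finset.sum_le_sum fun i _ => Finset.sum_le_sum fun j _ => ?_
        exact sq_le_sq.2 ((h i j).trans (le_abs_self s))
    _ = (N * s) ^ 2 := by simp; ring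

theorem hessian_isSymm {N : ℕ} {φ : RN N → ℝ} (hφ : ContDiff ℝ 2 φ) (x : RN N) :
    (hessian φ x).IsSymm := by
  ext i j
  have h : IsSymmSndFDerivAt ℝ φ x := hφ.contDiffAt.isSymmSndFDerivAt (by simp)
  simpa [hessian, iteratedFDeriv_two_apply] using h.eq _ _

theorem frobNorm_hessian_le {N : ℕ} (φ : RN N → ℝ) (x : RN N) :
    frobNorm (hessian φ x) ≤ N * ‖iteratedFDeriv ℝ 2 φ x‖ := by
  refine frobNorm_le_of_abs_le (fun i j => ?_) (norm_nonneg _)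
  have h := (iteratedFDeriv ℝ 2 φ x).le_opNorm
    ![EuclideanSpace.single i (1 : ℝ), EuclideanSpace.single j (1 : ℝ)]
  simpa [hessian, Fin.prod_univ_two] using h

theorem norm_gradient {N : ℕ} (φ : RN N → ℝ) (x : RN N) : ‖gradient φ x‖ = ‖fderiv ℝ φ x‖ := by
  simp [gradient]

theorem HomogeneousMat.map_zero {N : ℕ} {G : Mat N → ℝ} (hG : HomogeneousMat G) : G 0 = 0 := by
  have h := hG 2 0 two_pos Matrix.isSymm_zero
  rw [smul_zero] at h
  linarith

/-- Homogeneity forces `G 0 = 0`, so comparison with the zero matrix suffices. -/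
theorem LipschitzMat.exists_neg_mul_frobNorm_le {N : ℕ} {G : Mat N → ℝ} (hL : LipschitzMat G)
    (hG : HomogeneousMat G) :
    ∃ L : ℝ, 0 ≤ L ∧ ∀ X : Mat N, X.IsSymm → -(L * frobNorm X) ≤ G X := by
  obtain ⟨L, hL⟩ := hL
  refine ⟨|L|, abs_nonneg L, fun X hX => ?_⟩
  have h := hL X 0 hX Matrix.isSymm_zero
  rw [hG.map_zero, sub_zero, sub_zero] at h
  have h0 : 0 ≤ frobNorm X := Real.sqrt_nonneg _
  nlinarith [neg_abs_le (G X), le_abs_self L]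

/-- A `C²` function has bounded derivatives of order one and two on a compact set. -/
theorem ContDiff.exists_deriv_bound {N : ℕ} {φ : RN N → ℝ} (hφ : ContDiff ℝ 2 φ) {K : Set (RN N)}
    (hK : IsCompact K) :
    ∃ B : ℝ, 0 ≤ B ∧ ∀ x ∈ K, ‖fderiv ℝ φ x‖ ≤ B ∧ ‖iteratedFDeriv ℝ 2 φ x‖ ≤ B := by
  obtain ⟨B₁, h₁⟩ := hK.exists_bound_of_continuousOn
    (hφ.continuous_fderiv (by norm_num)).continuousOn
  obtain ⟨B₂, h₂⟩ := hK.exists_bound_of_continuousOn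
    (hφ.continuous_iteratedFDeriv (m := 2) le_rfl).continuousOn
  exact ⟨max 0 (max B₁ B₂), le_max_left _ _, fun x hx =>
    ⟨(h₁ x hx).trans (by simp), (h₂ x hx).trans (by simp)⟩⟩

/-- Superlinear growth in the gradient beats linear growth. -/
theorem eventually_superquadratic {m K c : ℝ} (hm : 2 < m) (hK : 0 < K) (hc : 0 < c)
    (d A B : ℝ) :
    ∀ᶠ a : ℝ in Filter.atTop, ∀ p : ℝ, a * c - d ≤ p → A * a + B < K * p ^ m := by
  -- The first two thresholds give `p ≥ a c / 2` and `p, a ≥ 1`; the third lets `K (a c / 2)²`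
  -- absorb the linear term.
  filter_upwards [Filter.eventually_ge_atTop (2 * (|d| + 1) / c), Filter.eventually_ge_atTop 1,
    Filter.eventually_ge_atTop (4 * (|A| + |B| + 1) / (K * c ^ 2))] with a h1 h2 h3 p hp
  rw [div_le_iff₀ hc] at h1
  rw [div_le_iff₀ (by positivity)] at h3
  have hac : a * c / 2 ≤ p := by linarith [le_abs_self d]
  have hp1 : 1 ≤ p := by linarith [abs_nonneg d]
  have hpm : p ^ 2 ≤ p ^ m := by
    simpa using Real.rpow_le_rpow_of_exponent_le hp1 hm.le
  have hp2 : (a * c / 2) ^ 2 ≤ p ^ 2 := by gcongr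
  calc A * a + B < (|A| + |B| + 1) * a := by
        nlinarith [le_abs_self A, le_abs_self B, abs_nonneg B]
    _ ≤ K * (a * c / 2) ^ 2 := by nlinarith
    _ ≤ K * p ^ m := by gcongr; exact hp2.trans hpm

theorem mainTheorem9 {N : ℕ} (Ω : Set (RN N)) (hΩo : IsOpen Ω) (hΩb : Bornology.IsBounded Ω)
    (hΩ : HasC3Boundary Ω)
    (F : Mat N → RN N → ℝ → RN N → ℝ)
    (hFc : ContinuousNonlinearity Ω F) (hFe : Elliptic Ω F)
    (m : ℝ) (hm : 2 < m) (hF : SuperquadraticGrowth m Ω F)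
    (g : RN N → ℝ) (hg : ContinuousOn g (frontier Ω))
    (u : RN N → ℝ) (hub : ∃ C : ℝ, ∀ x ∈ closure Ω, |u x| ≤ C)
    (husc : UpperSemicontinuousOn u (closure Ω))
    (hu : IsDirichletSubsolution Ω F g u) :
    ∀ x ∈ frontier Ω, u x ≤ g x := by
  intro x₀ hx₀
  by_contra! hlt
  have hx₀c : x₀ ∈ closure Ω := frontier_subset_closure hx₀
  obtain ⟨C, hC⟩ := hub
  have hR : 0 < |C| + 1 := by positivity
  obtain ⟨K₁, K₂, G, hK₁, -, hGL, -, hGh, hFG⟩ := hF (|C| + 1) hR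
  obtain ⟨L, hL0, hL⟩ := hGL.exists_neg_mul_frobNorm_le hGh
  obtain ⟨U, hU, ρ, hρ, hdρ, hρU⟩ := hΩ x₀ hx₀
  have hρ2 : ContDiff ℝ 2 ρ := hρ.of_le (by norm_num)
  have hdρ0 : 0 < ‖fderiv ℝ ρ x₀‖ := norm_pos_iff.2 hdρ
  set c := ‖fderiv ℝ ρ x₀‖ / 2 with hc
  have hc0 : 0 < c := by positivity
  have hev1 : ∀ᶠ x in 𝓝 x₀, c < ‖fderiv ℝ ρ x‖ :=
    (hρ2.continuous_fderiv (by norm_num)).norm.continuousAt.eventually_const_lt (by linarith)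
  -- The value `u x₀` is kept fixed, since `u` is only upper semicontinuous and may drop near `x₀`.
  have hev2 : ∀ᶠ x in 𝓝 x₀, x ∈ frontier Ω → g x < u x₀ :=
    eventually_nhdsWithin_iff.1 ((hg x₀ hx₀).eventually_lt_const hlt)
  have hev3 : ∀ᶠ x in 𝓝 x₀, x ∈ closure Ω → 0 ≤ ρ x := by
    filter_upwards [eventually_eventually_nhds.2 hU] with x hx hxc
    refine ge_of_tendsto (hρ2.continuous.continuousAt.continuousWithinAt (s := Ω)) ?_ (b := 0)
      (hx := mem_closure_iff_nhdsWithin_neBot.1 hxc)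
    filter_upwards [self_mem_nhdsWithin, mem_nhdsWithin_of_mem_nhds hx] with y hy hyU
    exact ((hρU y hyU).1 hy).le
  obtain ⟨r, hr, hball⟩ := Metric.nhds_basis_closedBall.eventually_iff.1
    (hev1.and (hev2.and hev3))
  have hρx₀ : ρ x₀ ≤ 0 := by
    refine not_lt.1 fun h => ?_
    rw [hΩo.frontier_eq] at hx₀
    exact hx₀.2 ((hρU x₀ (mem_of_mem_nhds hU)).2 h)
  set q : RN N → ℝ := fun x => ‖x - x₀‖ ^ 2 with hq
  have hq2 : ContDiff ℝ 2 q := (contDiff_id.sub contDiff_const).norm_sq ℝ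
  have hcomp : IsCompact (Metric.closedBall x₀ r) := isCompact_closedBall x₀ r
  obtain ⟨B, hB0, hB⟩ := hρ2.exists_deriv_bound hcomp
  obtain ⟨D, hD0, hD⟩ := hq2.exists_deriv_bound hcomp
  -- On the sphere of radius `r` the penalty equals `2|C| + 1`, more than `u` can oscillate, so the
  -- maximum point lies inside the ball whatever `a ≥ 0` is.
  set b := (2 * |C| + 1) / r ^ 2 with hb
  have hb0 : 0 < b := by positivity
  -- `a` is chosen last: `r`, `b`, `B` and `D` do not depend on it.
  obtain ⟨a, ha, ha0⟩ := ((eventually_superquadratic hm hK₁ hc0 (b * D) (L * (N * B))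
    (L * (N * (b * D)) + K₂)).and (Filter.eventually_ge_atTop 0)).exists
  set φ : RN N → ℝ := a • ρ + b • q with hφdef
  have hρa : ContDiff ℝ 2 (a • ρ) := contDiff_const.smul hρ2
  have hqb : ContDiff ℝ 2 (b • q) := contDiff_const.smul hq2
  have hφ : ContDiff ℝ 2 φ := hρa.add hqb
  have hSc : IsCompact (closure Ω ∩ Metric.closedBall x₀ r) :=
    hcomp.inter_left isClosed_closure
  have hx₀S : x₀ ∈ closure Ω ∩ Metric.closedBall x₀ r :=
    ⟨hx₀c, Metric.mem_closedBall_self hr.le⟩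
  have husc' : UpperSemicontinuousOn (fun y => u y - φ y)
      (closure Ω ∩ Metric.closedBall x₀ r) := by
    simp only [sub_eq_add_neg]
    exact (husc.mono inter_subset_left).add
      hφ.continuous.neg.continuousOn.upperSemicontinuousOn
  obtain ⟨x, ⟨hxc, hxb⟩, hmax⟩ := husc'.exists_isMaxOn ⟨x₀, hx₀S⟩ hSc
  obtain ⟨hxc1, hxg, hxρ⟩ := hball hxb
  have hxρ := hxρ hxc
  have hval : u x₀ + a * ρ x + b * ‖x - x₀‖ ^ 2 ≤ u x := by
    have h := hmax hx₀S
    simp only [mem_ofPred_eq, hφdef, hq, Pi.add_apply, Pi.smul_apply, smul_eq_mul, sub_self,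
      norm_zero] at h
    nlinarith
  have haρ : 0 ≤ a * ρ x := mul_nonneg ha0 hxρ
  have hux : u x₀ ≤ u x := by nlinarith [sq_nonneg ‖x - x₀‖]
  have hxr : ‖x - x₀‖ < r := by
    by_contra! h
    have h1 : b * r ^ 2 ≤ b * ‖x - x₀‖ ^ 2 := by gcongr
    rw [hb, div_mul_cancel₀ _ (by positivity), ← hb] at h1
    have h2 := abs_le.1 (hC x hxc)
    have h3 := abs_le.1 (hC x₀ hx₀c)
    linarith [le_abs_self C]
  have hloc : IsLocalMaxOn (fun y => u y - φ y) (closure Ω) x := by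
    filter_upwards [self_mem_nhdsWithin, mem_nhdsWithin_of_mem_nhds
      (Metric.isOpen_ball.mem_nhds (show x ∈ Metric.ball x₀ r by rwa [mem_ball_iff_norm]))]
      with y hy hyb
    exact hmax ⟨hy, Metric.ball_subset_closedBall hyb⟩
  obtain ⟨hin, hbd⟩ := hu φ hφ x hxc hloc
  have hFx : F (hessian φ x) (gradient φ x) (u x) x ≤ 0 := by
    by_cases hx : x ∈ Ω
    · exact hin hx
    · have hxf : x ∈ frontier Ω := by rw [hΩo.frontier_eq]; exact ⟨hxc, hx⟩
      -- The boundary alternative fails because `g x < u x₀ ≤ u x`.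
      refine (min_le_iff.1 (hbd hxf)).resolve_right (not_le.2 ?_)
      linarith [hxg hxf]
  have hgrow := hFG _ _ _ _ (hessian_isSymm hφ x)
    ((hC x hxc).trans ((le_abs_self C).trans (by linarith))) hxc hFx
  obtain ⟨-, hB2⟩ := hB x hxb
  obtain ⟨hD1, hD2⟩ := hD x hxb
  have hgrad : a * c - b * D ≤ ‖gradient φ x‖ := by
    rw [norm_gradient, hφdef, fderiv_add (hρa.differentiable (by norm_num) x)
      (hqb.differentiable (by norm_num) x), fderiv_const_smul (hρ2.differentiable (by norm_num) x),
      fderiv_const_smul (hq2.differentiable (by norm_num) x)]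
    have h := norm_sub_le_norm_add (a • fderiv ℝ ρ x) (b • fderiv ℝ q x)
    rw [norm_smul, norm_smul, Real.norm_of_nonneg ha0, Real.norm_of_nonneg hb0.le] at h
    have h1 : a * c ≤ a * ‖fderiv ℝ ρ x‖ := by gcongr
    have h2 : b * ‖fderiv ℝ q x‖ ≤ b * D := by gcongr
    linarith
  have hhess : ‖iteratedFDeriv ℝ 2 φ x‖ ≤ a * B + b * D := by
    rw [hφdef, iteratedFDeriv_add_apply hρa.contDiffAt hqb.contDiffAt, iteratedFDeriv_const_smul_apply hρ2.contDiffAt,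
      iteratedFDeriv_const_smul_apply hq2.contDiffAt]
    refine (norm_add_le _ _).trans ?_
    rw [norm_smul, norm_smul, Real.norm_of_nonneg ha0, Real.norm_of_nonneg hb0.le]
    gcongr
  have h1 := hL _ (hessian_isSymm hφ x)
  have h2 : L * frobNorm (hessian φ x) ≤ L * (N * (a * B + b * D)) := by
    gcongr
    exact (frobNorm_hessian_le φ x).trans (by gcongr)
  have h3 := ha _ hgrad
  nlinarith
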